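/- The tetrablock is $$\mathbb E=\{(x_1,x_2,x_3)\in\mathbb C^3:\ 1-zx_1-wx_2+zwx_3\neq 0 \text{ whenever } |z|\le 1,\ |w|\le 1\}.$$ An $\mathbb E$-contraction is a triple $(T_1,T_2,T_3)$ of commuting bounded operators on a complex Hilbert space whose Taylor joint spectrum satisfies $\sigma_T(T_1,T_2,T_3)\subseteq\overline{\mathbb E}$ and such that $$\|p(T_1,T_2,T_3)\|\le \sup_{(x_1,x_2,x_3)\in\overline{\mathbb E}}|p(x_1,x_2,x_3)|$$ for every complex polynomial $p$ in three variables. For a contraction $T$ put $D_T=(I-T^*T)^{1/2}$ and $\mathcal D_T=\overline{\operatorname{Ran}}\,D_T$. Let $[S,R]=SR-RS$, and let $\omega(A)=\sup\{|\langle Ax,x\rangle|:\|x\|=1\}$ be the numerical radius (equal to $0$ on the zero space). **Theorem.** Let $T_1,T_2,T_3$ be commuting contractions on a complex Hilbert space $\mathcal H$. Let $A_1,A_2$ be two commuting bounded operators on $\mathcal D_{T_3}$ such that $$T_1-T_2^*T_3=D_{T_3}A_1D_{T_3}\quad\text{and}\quad T_2-T_1^*T_3=D_{T_3}A_2D_{T_3}.$$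 If $[A_1^*,A_1]=[A_2^*,A_2]$ and $\omega(A_1+A_2z)\le 1$ for all $z\in\mathbb C$ with $|z|=1$, then $(T_1,T_2,T_3)$ is an $\mathbb E$-contraction. -/

import Mathlib

open ContinuousLinearMap

noncomputable section

namespace Tetrablock

/-- The tetrablock `𝔼 ⊆ ℂ³`. -/
def tetrablock : Set (Fin 3 → ℂ) :=
  {x | ∀ z w : ℂ, ‖z‖ ≤ 1 → ‖w‖ ≤ 1 → 1 - z * x 0 - w * x 1 + z * w * x 2 ≠ 0}

section Koszul

variable {X : Type*} [NormedAddCommGroup X] [NormedSpace ℂ X]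

/-- A triple of operators on `X` is Taylor regular if its Koszul complex
`0 → X → X³ → X³ → X → 0` is exact. Here the maps are
`x ↦ (T₁ x, T₂ x, T₃ x)`,
`(x₁, x₂, x₃) ↦ (T₂ x₃ - T₃ x₂, T₃ x₁ - T₁ x₃, T₁ x₂ - T₂ x₁)` and
`(y₁, y₂, y₃) ↦ T₁ y₁ + T₂ y₂ + T₃ y₃`. For a commuting triple the composite of two consecutive
maps is zero, so exactness is what the four clauses say. -/
structure TaylorRegular (T : Fin 3 → X →L[ℂ] X) : Prop where
  exact_first : ∀ x : X, T 0 x = 0 → T 1 x = 0 → T 2 x = 0 → x = 0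
  exact_second : ∀ x₁ x₂ x₃ : X,
    T 1 x₃ - T 2 x₂ = 0 → T 2 x₁ - T 0 x₃ = 0 → T 0 x₂ - T 1 x₁ = 0 →
      ∃ x : X, T 0 x = x₁ ∧ T 1 x = x₂ ∧ T 2 x = x₃
  exact_third : ∀ y₁ y₂ y₃ : X, T 0 y₁ + T 1 y₂ + T 2 y₃ = 0 →
    ∃ x₁ x₂ x₃ : X,
      T 1 x₃ - T 2 x₂ = y₁ ∧ T 2 x₁ - T 0 x₃ = y₂ ∧ T 0 x₂ - T 1 x₁ = y₃
  exact_fourth : ∀ y : X, ∃ y₁ y₂ y₃ : X, T 0 y₁ + T 1 y₂ + T 2 y₃ = y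

/-- The Taylor joint spectrum of a (commuting) triple of operators. -/
def taylorSpectrum (T : Fin 3 → X →L[ℂ] X) : Set (Fin 3 → ℂ) :=
  {l | ¬ TaylorRegular (fun i => T i - l i • (1 : X →L[ℂ] X))}

/-- `p(T₁, T₂, T₃)` for a polynomial `p` in three variables and a (commuting) triple. -/
def polyEval (T : Fin 3 → X →L[ℂ] X) (p : MvPolynomial (Fin 3) ℂ) : X →L[ℂ] X :=
  ∑ m ∈ p.support, p.coeff m • (T 0 ^ m 0 * T 1 ^ m 1 * T 2 ^ m 2)

end Koszul

/-- The supremum of `|p|` over the closed tetrablock, a nonempty compact set. -/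
def supNorm (p : MvPolynomial (Fin 3) ℂ) : ℝ :=
  sSup ((fun x => ‖MvPolynomial.eval x p‖) '' closure tetrablock)

section Hilbert

variable {H : Type*} [NormedAddCommGroup H] [InnerProductSpace ℂ H]

/-- An `𝔼`-contraction: a commuting triple of bounded operators that has the closed tetrablock as
a spectral set. -/
structure IsEContraction (T : Fin 3 → H →L[ℂ] H) : Prop where
  commute : ∀ i j, Commute (T i) (T j)
  spectrum_subset : taylorSpectrum T ⊆ closure tetrablock
  norm_le : ∀ p : MvPolynomial (Fin 3) ℂ, ‖polyEval T p‖ ≤ supNorm p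

/-- The numerical radius `ω(A) = sup {|⟨A x, x⟩| : ‖x‖ = 1}` (equal to `0` on the zero space). -/
def numericalRadius (A : H →L[ℂ] H) : ℝ :=
  sSup {r : ℝ | ∃ x : H, ‖x‖ = 1 ∧ r = ‖inner ℂ (A x) x‖}

variable [CompleteSpace H]

/-- The defect operator `D_T = (I - T* T)^{1/2}` of a contraction `T`. -/
def defect (T : H →L[ℂ] H) : H →L[ℂ] H := CFC.sqrt (1 - adjoint T * T)

/-- The defect space `𝒟_T`, the closure of the range of `D_T`. -/
def defectSpace (T : H →L[ℂ] H) : Submodule ℂ H :=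
  (LinearMap.range (defect T).toLinearMap).topologicalClosure

instance (T : H →L[ℂ] H) : CompleteSpace (defectSpace T) :=
  inferInstanceAs
    (CompleteSpace (LinearMap.range (defect T).toLinearMap).topologicalClosure)

theorem defect_mem_defectSpace (T : H →L[ℂ] H) (h : H) : defect T h ∈ defectSpace T :=
  Submodule.le_topologicalClosure _ (LinearMap.mem_range_self _ h)

/-- `D_T` as an operator from `H` into `𝒟_T`. -/
def defectTo (T : H →L[ℂ] H) : H →L[ℂ] defectSpace T :=
  (defect T).codRestrict (defectSpace T) (defect_mem_defectSpace T)

/-- `D_T A D_T` as an operator on `H`, where `A` is an operator on `𝒟_T`. -/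
def defectCompress (T : H →L[ℂ] H) (A : defectSpace T →L[ℂ] defectSpace T) : H →L[ℂ] H :=
  (defect T).comp ((defectSpace T).subtypeL.comp (A.comp (defectTo T)))

end Hilbert

end Tetrablock

end

namespace Tetrablock

open Filter Topology MvPolynomial

/-! The triple dilates to an `𝔼`-isometry. On `H ⊕ ℓ²(𝒟)` let `V₁, V₂, V₃` be lower triangular, with
diagonal entries `Tᵢ` and the Toeplitz operators of symbols `A₁ + zA₂*`, `A₂ + zA₁*`, `z`, while
`A₂*D`, `A₁*D`, `D` map `H` into coordinate 0. The fundamental equations give `DT₁ = A₁D + A₂*DT₃`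
and its mirror image. With `A₁A₂ = A₂A₁` and equal self-commutators, these make the `Vᵢ` commute,
with `V₃` an isometry and `V₁ = V₂*V₃`. The projection `P` onto `H` satisfies `PVᵢ = TᵢP`, so norm
bounds pass from `p(V)` to `p(T)` (`IsEContraction.of_intertwine`).

No unitary extension of `V` is needed. Each `x = p(V)` satisfies `q = x*V₃ⁿ`, `x = q*V₃ⁿ` for some
`q` in the bicommutant; this makes `x` hyponormal, so its norm is its spectral radius. Characters of
the bicommutant send `V` into the closed tetrablock, because the defining pencils are invertible
there, and Gelfand theory bounds `‖p(V)‖` (`norm_polyEval_le_supNorm`).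

Invertibility of the pencils rests on `‖V₁‖ ≤ 1`. Each `A₁ + ζA₂*` with `|ζ| = 1` is normal of
numerical radius at most 1, hence a contraction. So both diagonal blocks of `V₁` are contractions,
its powers grow at most linearly, and, as its norm is its spectral radius, `‖V₁‖ ≤ 1`.

For the Taylor spectrum, the pencils of `T` inherit invertibility from those estimates, and an
inverse commuting with `T` contracts the Koszul complex at every point off the closed tetrablock. -/

/-! ### Closure and compactness of the tetrablock. -/

theorem mem_closure_tetrablock {x : Fin 3 → ℂ}
    (h : ∀ z w : ℂ, ‖z‖ < 1 → ‖w‖ < 1 → 1 - z * x 0 - w * x 1 + z * w * x 2 ≠ 0) :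
    x ∈ closure tetrablock := by
  -- The weights 1, 1, 2 turn the pencil of `f r` at `(z, w)` into the pencil of `x` at `(rz, rw)`.
  let f : ℝ → Fin 3 → ℂ := fun r => ![(r : ℂ) * x 0, (r : ℂ) * x 1, (r : ℂ) * (r : ℂ) * x 2]
  have hf : Continuous f := by
    refine continuous_pi fun i => ?_
    fin_cases i <;> simp [f] <;> fun_prop
  have h1 : f 1 = x := by
    ext i; fin_cases i <;> simp [f]
  have hlim : Tendsto f (𝓝[<] 1) (𝓝 x) := by
    have := hf.tendsto 1
    rw [h1] at this
    exact this.mono_left nhdsWithin_le_nhds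
  refine mem_closure_of_tendsto hlim ?_
  have hI : Set.Ioo (0 : ℝ) 1 ∈ 𝓝[<] (1 : ℝ) := Ioo_mem_nhdsLT one_pos
  filter_upwards [hI] with r hr z w hz hw
  have hb : ∀ u : ℂ, ‖u‖ ≤ 1 → ‖u * r‖ < 1 := fun u hu => by
    rw [norm_mul, Complex.norm_real, Real.norm_of_nonneg hr.1.le]
    exact mul_lt_one_of_nonneg_of_lt_one_right hu hr.1.le hr.2
  have := h (z * r) (w * r) (hb z hz) (hb w hw)
  convert this using 1
  simp [f]
  ring

theorem norm_le_of_mem_tetrablock {x : Fin 3 → ℂ} (hx : x ∈ tetrablock) (i : Fin 3) :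
    ‖x i‖ ≤ 3 := by
  have key : ∀ a b : ℂ, a ≠ 0 → (∀ w : ℂ, ‖w‖ ≤ 1 → a - w * b ≠ 0) → ‖b‖ ≤ ‖a‖ := by
    intro a b ha hab
    by_contra! hlt
    have hb : b ≠ 0 := by
      rintro rfl
      simp at hlt
      linarith [norm_nonneg a]
    -- If `|a| < |b|`, the root `a / b` lies in the disc.
    refine hab (a / b) ?_ (by field_simp; ring)
    rw [norm_div]
    exact div_le_one_of_le₀ hlt.le (norm_nonneg _)
  have h0 : ‖x 0‖ ≤ 1 := by
    simpa using key 1 (x 0) one_ne_zero fun w hw => by simpa using hx w 0 hw (by simp)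
  have h1 : ‖x 1‖ ≤ 1 := by
    simpa using key 1 (x 1) one_ne_zero fun w hw => by simpa using hx 0 w (by simp) hw
  have h2 : ‖x 1 - x 2‖ ≤ ‖1 - x 0‖ := by
    refine key _ _ (by simpa using hx 1 0 (by simp) (by simp)) fun w hw => ?_
    convert hx 1 w (by simp) hw using 1
    ring
  have h3 : ‖x 2‖ ≤ 3 := by
    have e : x 2 = x 1 - (x 1 - x 2) := by ring
    have := norm_sub_le (x 1) (x 1 - x 2)
    rw [← e] at this
    have := norm_sub_le 1 (x 0)
    rw [norm_one] at this
    linarith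
  fin_cases i
  · exact h0.trans (by norm_num)
  · exact h1.trans (by norm_num)
  · exact h3

theorem isCompact_closure_tetrablock : IsCompact (closure tetrablock) := by
  refine Bornology.IsBounded.isCompact_closure ?_
  refine (Metric.isBounded_closedBall (x := (0 : Fin 3 → ℂ)) (r := 3)).subset fun x hx => ?_
  rw [mem_closedBall_zero_iff, pi_norm_le_iff_of_nonneg (by norm_num)]
  exact norm_le_of_mem_tetrablock hx

theorem norm_eval_le_supNorm (p : MvPolynomial (Fin 3) ℂ) {x : Fin 3 → ℂ}
    (hx : x ∈ closure tetrablock) : ‖eval x p‖ ≤ supNorm p := by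
  refine le_csSup ?_ ⟨x, hx, rfl⟩
  exact (isCompact_closure_tetrablock.image
    (p.continuous_eval.norm)).bddAbove

theorem supNorm_nonneg (p : MvPolynomial (Fin 3) ℂ) : 0 ≤ supNorm p :=
  Real.sSup_nonneg (by rintro _ ⟨x, -, rfl⟩; exact norm_nonneg _)

/-! ### Gelfand theory in a commutative Banach algebra. -/

section BanachAlgebra

theorem spectralRadius_eq_nnnorm_of_norm_pow {A : Type*} [NormedRing A] [NormedAlgebra ℂ A]
    [CompleteSpace A] {a : A} (ha : ∀ n : ℕ, ‖a ^ 2 ^ n‖ = ‖a‖ ^ 2 ^ n) :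
    spectralRadius ℂ a = ‖a‖₊ := by
  have h1 := spectrum.pow_nnnorm_pow_one_div_tendsto_nhds_spectralRadius a
  have h2 := h1.comp (tendsto_pow_atTop_atTop_of_one_lt (one_lt_two : (1 : ℕ) < 2))
  refine tendsto_nhds_unique h2 (tendsto_const_nhds.congr fun n => ?_)
  have : ‖a ^ 2 ^ n‖₊ = ‖a‖₊ ^ 2 ^ n := NNReal.eq (by simpa using ha n)
  rw [Function.comp_apply, this, ENNReal.coe_pow, ← ENNReal.rpow_natCast, ← ENNReal.rpow_mul]
  rw [mul_one_div_cancel (by positivity), ENNReal.rpow_one]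

variable {A : Type*} [NormedCommRing A] [NormedAlgebra ℂ A] [CompleteSpace A]

/-- Every spectral value of `p(a)` is `p(φ(a))` for a character `φ`, and `φ(a)` is in the closed
tetrablock since `φ` maps units to nonzero numbers. The power hypothesis turns spectral radius into
norm. -/
theorem norm_aeval_le_supNorm {a : Fin 3 → A}
    (ha : ∀ z w : ℂ, ‖z‖ < 1 → ‖w‖ < 1 → IsUnit (1 - z • a 0 - w • a 1 + (z * w) • a 2))
    {p : MvPolynomial (Fin 3) ℂ} (hp : ∀ n : ℕ, ‖aeval a p ^ 2 ^ n‖ = ‖aeval a p‖ ^ 2 ^ n) :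
    ‖aeval a p‖ ≤ supNorm p := by
  have hr : spectralRadius ℂ (aeval a p) ≤ ENNReal.ofReal (supNorm p) := by
    refine iSup₂_le fun k hk => ?_
    obtain ⟨φ, rfl⟩ := WeakDual.CharacterSpace.mem_spectrum_iff_exists.1 hk
    have e : φ (aeval a p) = eval (fun i => φ (a i)) p := by
      rw [aeval_def, eval₂_eq', eval_eq', map_sum]
      refine Finset.sum_congr rfl fun d _ => ?_
      rw [map_mul, AlgHomClass.commutes, map_prod]
      simp only [map_pow, Algebra.algebraMap_self, RingHom.id_apply]
    have hmem : (fun i => φ (a i)) ∈ closure tetrablock := by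
      refine mem_closure_tetrablock fun z w hz hw => ?_
      have := ((ha z w hz hw).map φ).ne_zero
      simpa [map_add, map_sub, map_one, map_smul] using this
    rw [e, ← enorm_eq_nnnorm, ← ofReal_norm]
    exact ENNReal.ofReal_le_ofReal (norm_eval_le_supNorm p hmem)
  rw [spectralRadius_eq_nnnorm_of_norm_pow hp, ← enorm_eq_nnnorm, ← ofReal_norm] at hr
  exact (ENNReal.ofReal_le_ofReal_iff (supNorm_nonneg p)).1 hr

/-- The linear pencil `1 - z a₀ - w a₁ + z w a₂` is invertible once `1 - z a₀` is, and the quotient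
`(a₁ - z a₂) (1 - z a₀)⁻¹` is a contraction. -/
theorem isUnit_pencil {a : Fin 3 → A} {z w : ℂ} {u : Aˣ} (hu : (u : A) = 1 - z • a 0)
    (hw : ‖w‖ < 1) (h : ‖(a 1 - z • a 2) * ↑u⁻¹‖ ≤ 1) :
    IsUnit (1 - z • a 0 - w • a 1 + (z * w) • a 2) := by
  have h1 : IsUnit (1 - w • ((a 1 - z • a 2) * ↑u⁻¹)) := by
    refine isUnit_one_sub_of_norm_lt_one ?_
    calc _ ≤ ‖w‖ * ‖(a 1 - z • a 2) * ↑u⁻¹‖ := norm_smul_le _ _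
      _ ≤ ‖w‖ * 1 := by gcongr
      _ < 1 := by simpa
  have h2 : 1 - z • a 0 - w • a 1 + (z * w) • a 2
      = (1 - w • ((a 1 - z • a 2) * ↑u⁻¹)) * u := by
    rw [sub_mul, smul_mul_assoc, mul_assoc, u.inv_mul, hu]
    simp only [one_mul, mul_one]
    module
  rw [h2]
  exact h1.mul u.isUnit

end BanachAlgebra

/-! ### Exactness of the Koszul complex. -/

section Koszul

variable {X : Type*} [NormedAddCommGroup X] [NormedSpace ℂ X]

/-- The `Rᵢ` define a contracting homotopy of the Koszul complex. -/
theorem TaylorRegular.of_sum_mul_eq_one {T R : Fin 3 → X →L[ℂ] X}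
    (hT : ∀ i j, Commute (T i) (T j)) (hR : ∀ i j, Commute (R i) (T j))
    (h : R 0 * T 0 + R 1 * T 1 + R 2 * T 2 = 1) : TaylorRegular T := by
  have hT' : ∀ i j x, T i (T j x) = T j (T i x) := fun i j x => DFunLike.congr_fun (hT i j) x
  have hR' : ∀ i j x, R i (T j x) = T j (R i x) := fun i j x => DFunLike.congr_fun (hR i j) x
  have h' : ∀ x, R 0 (T 0 x) + R 1 (T 1 x) + R 2 (T 2 x) = x := fun x => DFunLike.congr_fun h x
  have hs : ∀ x, T 0 (R 0 x) + T 1 (R 1 x) + T 2 (R 2 x) = x := fun x => by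
    simpa only [hR'] using h' x
  refine ⟨fun x h0 h1 h2 => ?_, fun x₁ x₂ x₃ h1 h2 h3 => ?_, fun y₁ y₂ y₃ hy => ?_,
    fun y => ⟨R 0 y, R 1 y, R 2 y, hs y⟩⟩
  · rw [← h' x, h0, h1, h2]; simp
  · rw [sub_eq_zero] at h1 h2 h3
    refine ⟨R 0 x₁ + R 1 x₂ + R 2 x₃, ?_, ?_, ?_⟩
    · simp only [map_add, ← hR', h3, ← h2]; exact h' x₁
    · simp only [map_add, ← hR', ← h3, h1]; exact h' x₂
    · simp only [map_add, ← hR', h2, ← h1]; exact h' x₃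
  · have e1 : T 0 y₁ = - (T 1 y₂ + T 2 y₃) := by rw [← sub_eq_zero, ← hy]; abel
    have e2 : T 1 y₂ = - (T 0 y₁ + T 2 y₃) := by rw [← sub_eq_zero, ← hy]; abel
    have e3 : T 2 y₃ = - (T 0 y₁ + T 1 y₂) := by rw [← sub_eq_zero, ← hy]; abel
    -- This is `y × R`: the triple product gives `T × (y × R) = (R·T) y - R (T·y) = y`, as `T·y =
    -- 0`.
    refine ⟨R 2 y₂ - R 1 y₃, R 0 y₃ - R 2 y₁, R 1 y₁ - R 0 y₂, ?_, ?_, ?_⟩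
    · conv_rhs => rw [← h' y₁, e1]
      simp only [map_sub, map_add, map_neg, ← hR']; abel
    · conv_rhs => rw [← h' y₂, e2]
      simp only [map_sub, map_add, map_neg, ← hR']; abel
    · conv_rhs => rw [← h' y₃, e3]
      simp only [map_sub, map_add, map_neg, ← hR']; abel

/-- The Taylor spectrum of a triple lies in the closed tetrablock if the linear pencils defining
the tetrablock have inverses commuting with the triple. -/
theorem taylorSpectrum_subset_closure_tetrablock {T : Fin 3 → X →L[ℂ] X}
    (hT : ∀ i j, Commute (T i) (T j))
    (h : ∀ z w : ℂ, ‖z‖ < 1 → ‖w‖ < 1 → ∃ G : X →L[ℂ] X, (∀ i, Commute G (T i)) ∧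
      G * (1 - z • T 0 - w • T 1 + (z * w) • T 2) = 1) :
    taylorSpectrum T ⊆ closure tetrablock := by
  intro l hl
  by_contra hcl
  apply hl
  have : ∃ z w : ℂ, ‖z‖ < 1 ∧ ‖w‖ < 1 ∧ 1 - z * l 0 - w * l 1 + z * w * l 2 = 0 := by
    by_contra! hne
    exact hcl (mem_closure_tetrablock hne)
  obtain ⟨z, w, hz, hw, hl0⟩ := this
  obtain ⟨G, hG, hG1⟩ := h z w hz hw
  have hc : ∀ i, Commute G (T i - l i • 1) := fun i =>
    (hG i).sub_right ((Commute.one_right G).smul_right _)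
  refine TaylorRegular.of_sum_mul_eq_one (R := ![(-z) • G, (-w) • G, (z * w) • G]) ?_ ?_ ?_
  · intro i j
    exact ((hT i j).sub_right ((Commute.one_right _).smul_right _)).sub_left
      (((Commute.one_left _).smul_left _))
  · intro i j
    fin_cases i <;> exact (hc j).smul_left _
  -- Since the pencil vanishes at `l`, the operator pencil is a combination of the `T i - l i`.
  · have e : (1 : X →L[ℂ] X) - z • T 0 - w • T 1 + (z * w) • T 2
        = (-z) • (T 0 - l 0 • 1) + (-w) • (T 1 - l 1 • 1) + (z * w) • (T 2 - l 2 • 1) := by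
      rw [← sub_eq_zero]
      have : (1 - z * l 0 - w * l 1 + z * w * l 2) • (1 : X →L[ℂ] X) = 0 := by
        rw [hl0, zero_smul]
      rw [← this]
      module
    rw [e] at hG1
    refine Eq.trans ?_ hG1
    simp only [mul_add, mul_smul_comm, smul_mul_assoc, Matrix.cons_val]

end Koszul

/-! ### The bicommutant as a commutative Banach algebra. -/

section Bicommutant

open MvPolynomial

variable {X : Type*} [NormedAddCommGroup X] [NormedSpace ℂ X]

/-- The double commutant of a triple of operators. -/
def bicommutant (T : Fin 3 → X →L[ℂ] X) : Subalgebra ℂ (X →L[ℂ] X) :=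
  Subalgebra.centralizer ℂ (Set.centralizer (Set.range T))

theorem mem_bicommutant (T : Fin 3 → X →L[ℂ] X) (i : Fin 3) : T i ∈ bicommutant T :=
  Set.subset_centralizer_centralizer (Set.mem_range_self i)

theorem commute_of_mem_bicommutant {T : Fin 3 → X →L[ℂ] X} (hT : ∀ i j, Commute (T i) (T j))
    {x y : X →L[ℂ] X} (hx : x ∈ bicommutant T) (hy : y ∈ bicommutant T) : Commute x y :=
  Set.centralizer_centralizer_comm_of_comm
    (by rintro _ ⟨i, rfl⟩ _ ⟨j, rfl⟩; exact hT i j) x hx y hy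

/-- The double commutant of a commuting triple as a commutative Banach algebra. -/
def BicommutantAlgebra (T : Fin 3 → X →L[ℂ] X) (_ : ∀ i j, Commute (T i) (T j)) : Type _ :=
  bicommutant T

namespace BicommutantAlgebra

variable {T : Fin 3 → X →L[ℂ] X} {hT : ∀ i j, Commute (T i) (T j)}

noncomputable instance : NormedRing (BicommutantAlgebra T hT) :=
  inferInstanceAs (NormedRing (bicommutant T))

noncomputable instance : NormedCommRing (BicommutantAlgebra T hT) :=
  { (inferInstance : NormedRing (BicommutantAlgebra T hT)) with
    mul_comm := fun x y => Subtype.ext (commute_of_mem_bicommutant hT x.2 y.2) }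

noncomputable instance : NormedAlgebra ℂ (BicommutantAlgebra T hT) :=
  inferInstanceAs (NormedAlgebra ℂ (bicommutant T))

instance [CompleteSpace X] : CompleteSpace (BicommutantAlgebra T hT) :=
  (Set.isClosed_centralizer _ : IsClosed (bicommutant T : Set (X →L[ℂ] X))).completeSpace_coe

/-- The inclusion of the double commutant into the algebra of all operators. -/
def val : BicommutantAlgebra T hT →ₐ[ℂ] X →L[ℂ] X := (bicommutant T).val

theorem norm_val (x : BicommutantAlgebra T hT) : ‖val x‖ = ‖x‖ := rfl

theorem val_mem (x : BicommutantAlgebra T hT) : val x ∈ bicommutant T := Subtype.property x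

variable (hT) in
/-- A triple of operators as elements of its double commutant. -/
def gen (i : Fin 3) : BicommutantAlgebra T hT := ⟨T i, mem_bicommutant T i⟩

theorem val_gen (i : Fin 3) : val (gen hT i) = T i := rfl

theorem val_aeval_gen (p : MvPolynomial (Fin 3) ℂ) : val (aeval (gen hT) p) = polyEval T p := by
  rw [aeval_def, eval₂_eq', polyEval, map_sum]
  refine Finset.sum_congr rfl fun d _ => ?_
  rw [Fin.prod_univ_three, ← Algebra.smul_def]
  simp only [map_smul, map_mul, map_pow, val_gen]

end BicommutantAlgebra

open BicommutantAlgebra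

/-- If `‖T₁‖ ≤ 1` and `(T₂ - z T₃) (1 - z T₁)⁻¹` is a contraction for all `z` in the disc, then the
pencils `1 - z T₁ - w T₂ + z w T₃` are invertible in the double commutant. -/
theorem isUnit_pencil_gen [CompleteSpace X] {T : Fin 3 → X →L[ℂ] X}
    (hT : ∀ i j, Commute (T i) (T j)) (h0 : ‖T 0‖ ≤ 1)
    (h : ∀ z : ℂ, ‖z‖ < 1 → ∀ G : X →L[ℂ] X, (1 - z • T 0) * G = 1 → G * (1 - z • T 0) = 1 →
      ‖(T 1 - z • T 2) * G‖ ≤ 1) {z w : ℂ} (hz : ‖z‖ < 1) (hw : ‖w‖ < 1) :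
    IsUnit (1 - z • gen hT 0 - w • gen hT 1 + (z * w) • gen hT 2) := by
  have h1 : IsUnit (1 - z • gen hT 0) := by
    refine isUnit_one_sub_of_norm_lt_one ((norm_smul_le _ _).trans_lt ?_)
    rw [← norm_val, val_gen]
    exact mul_lt_one_of_nonneg_of_lt_one_left (norm_nonneg _) hz h0
  obtain ⟨u, hu⟩ := h1
  have hval : val (u : BicommutantAlgebra T hT) = 1 - z • T 0 := by
    rw [hu, map_sub, map_one, map_smul, val_gen]
  refine isUnit_pencil hu hw ?_
  rw [← norm_val, map_mul, map_sub, map_smul, val_gen, val_gen]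
  refine h z hz _ ?_ ?_
  · rw [← hval, ← map_mul, u.mul_inv, map_one]
  · rw [← hval, ← map_mul, u.inv_mul, map_one]

end Bicommutant

/-! ### Reversible elements form an algebra. -/

section Reversible

variable {B : Type*} [Ring B] [StarRing B]

theorem star_pow_mul_pow_of_star_mul_self {v : B} (hv : star v * v = 1) (n : ℕ) :
    star (v ^ n) * v ^ n = 1 := by
  induction n with
  | zero => simp
  | succ n ih =>
    rw [pow_succ', star_mul, mul_assoc, ← mul_assoc (star v), hv, one_mul, ih]

variable [Algebra ℂ B]

/-- `x` is reversible with respect to the commutative algebra `A` and `v ∈ A` if `x* vⁿ` lies in `A`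
for some `n`, with `(x* vⁿ)* vⁿ = x`. -/
def Reversible (A : Subalgebra ℂ B) (v x : B) : Prop :=
  ∃ n : ℕ, ∃ q ∈ A, star x * v ^ n = q ∧ star q * v ^ n = x

variable {A : Subalgebra ℂ B} {v : B}

theorem Reversible.algebraMap [StarModule ℂ B] (c : ℂ) : Reversible A v (algebraMap ℂ B c) :=
  ⟨0, _, A.algebraMap_mem (star c), by
    simpa using (algebraMap_star_comm c).symm, by simp [← algebraMap_star_comm]⟩

theorem Reversible.add (hA : ∀ x ∈ A, ∀ y ∈ A, x * y = y * x) (hv : v ∈ A) (hvv : star v * v = 1)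
    {x y : B} (hxA : x ∈ A) (hyA : y ∈ A) (hx : Reversible A v x) (hy : Reversible A v y) :
    Reversible A v (x + y) := by
  obtain ⟨n, q, hq, hxq, hqx⟩ := hx
  obtain ⟨m, r, hr, hyr, hry⟩ := hy
  -- The exponent can be raised by `l`: `t` commutes with `v ^ l`, and the isometry `v` cancels its
  -- adjoint. So both summands may use exponent `n + m`.
  have aux : ∀ (k l : ℕ) (s t : B), t ∈ A → star s * v ^ k = t →
      star (s * v ^ l) * v ^ (l + k) = t := by
    intro k l s t _ hst
    rw [star_mul, add_comm l k, pow_add, mul_assoc, ← mul_assoc (star s), hst,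
      ← hA _ (A.pow_mem hv l) t ‹_›, ← mul_assoc, star_pow_mul_pow_of_star_mul_self hvv, one_mul]
  refine ⟨n + m, q * v ^ m + r * v ^ n, A.add_mem (A.mul_mem hq (A.pow_mem hv m))
    (A.mul_mem hr (A.pow_mem hv n)), ?_, ?_⟩
  · rw [star_add, add_mul, pow_add, ← mul_assoc, hxq, ← pow_add, add_comm n m, pow_add,
      ← mul_assoc, hyr]
  · rw [star_add, add_mul, add_comm n m, aux n m q x hxA hqx, add_comm m n, aux m n r y hyA hry]

theorem Reversible.mul (hA : ∀ x ∈ A, ∀ y ∈ A, x * y = y * x) (hv : v ∈ A)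
    {x y : B} (hxA : x ∈ A) (hyA : y ∈ A) (hx : Reversible A v x) (hy : Reversible A v y) :
    Reversible A v (x * y) := by
  obtain ⟨n, q, hq, hxq, hqx⟩ := hx
  obtain ⟨m, r, hr, hyr, hry⟩ := hy
  have aux : ∀ s t s' t' : B, t ∈ A → t' ∈ A → star s * v ^ n = t → star s' * v ^ m = t' →
      star (s * s') * v ^ (n + m) = t * t' := by
    intro s t s' t' ht ht' h h'
    rw [star_mul, pow_add, mul_assoc, ← mul_assoc (star s), h, hA t ht _ (A.pow_mem hv m),
      ← mul_assoc, h', hA _ ht _ ht']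
  exact ⟨n + m, q * r, A.mul_mem hq hr, aux x q y r hq hr hxq hyr, aux q x r y hxA hyA hqx hry⟩

end Reversible

/-! ### Hyponormality, `𝔼`-isometries and their compressions. -/

section Hilbert

variable {K : Type*} [NormedAddCommGroup K] [InnerProductSpace ℂ K] [CompleteSpace K]

/-- Reversible elements are hyponormal, hence normaloid. -/
theorem Reversible.norm_mul_self {A : Subalgebra ℂ (K →L[ℂ] K)} {v x : K →L[ℂ] K}
    (hA : ∀ x ∈ A, ∀ y ∈ A, x * y = y * x) (hv : star v * v = 1) (hxA : x ∈ A)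
    (hx : Reversible A v x) : ‖x * x‖ = ‖x‖ * ‖x‖ := by
  obtain ⟨n, q, hq, hxq, hqx⟩ := hx
  have hsq : star x * x = star q * q := by
    calc star x * x = star x * (star q * v ^ n) := by rw [hqx]
      _ = star (q * x) * v ^ n := by rw [star_mul, mul_assoc]
      _ = star q * q := by rw [hA q hq x hxA, star_mul, mul_assoc, hxq]
  have hvn : ‖v ^ n‖ ≤ 1 := by
    have h1 := CStarRing.norm_star_mul_self (x := v ^ n)
    rw [star_pow_mul_pow_of_star_mul_self hv] at h1
    have h2 : ‖(1 : K →L[ℂ] K)‖ ≤ 1 := ContinuousLinearMap.norm_id_le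
    nlinarith [norm_nonneg (v ^ n)]
  have hqn : ∀ h, ‖q h‖ = ‖x h‖ := by
    intro h
    have e := congrArg (fun f : K →L[ℂ] K => inner ℂ (f h) h) hsq
    simp only [mul_apply_eq_comp, star_eq_adjoint, adjoint_inner_left,
      inner_self_eq_norm_sq_to_K] at e
    have e' : ‖x h‖ ^ 2 = ‖q h‖ ^ 2 := by exact_mod_cast e
    exact ((sq_eq_sq₀ (norm_nonneg _) (norm_nonneg _)).1 e').symm
  -- Hyponormality: `x* = (vⁿ)* q` with `vⁿ` a contraction, and `‖q h‖ = ‖x h‖`.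
  have hstar : ∀ h, ‖adjoint x h‖ ≤ ‖x h‖ := by
    intro h
    have e : star x = star (v ^ n) * q := by rw [← hqx, star_mul, star_star]
    have : adjoint x h = star (v ^ n) (q h) := by rw [← star_eq_adjoint, e]; rfl
    rw [this, ← hqn h]
    refine (le_opNorm _ _).trans ?_
    rw [norm_star]
    exact mul_le_of_le_one_left (norm_nonneg _) hvn
  refine le_antisymm (norm_mul_le _ _) ?_
  have : ‖x‖ ≤ Real.sqrt ‖x * x‖ := by
    refine opNorm_le_bound _ (Real.sqrt_nonneg _) fun h => ?_
    refine abs_le_of_sq_le_sq' ?_ (by positivity) |>.2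
    rw [mul_pow, Real.sq_sqrt (norm_nonneg _)]
    calc ‖x h‖ ^ 2 = ‖inner ℂ (adjoint x (x h)) h‖ := by
          rw [adjoint_inner_left, inner_self_eq_norm_sq_to_K]; simp
      _ ≤ ‖adjoint x (x h)‖ * ‖h‖ := norm_inner_le_norm _ _
      _ ≤ ‖(x * x) h‖ * ‖h‖ := by gcongr; exact hstar _
      _ ≤ ‖x * x‖ * ‖h‖ * ‖h‖ := by gcongr; exact le_opNorm _ _
      _ = ‖x * x‖ * ‖h‖ ^ 2 := by ring
  calc ‖x‖ * ‖x‖ ≤ Real.sqrt ‖x * x‖ * Real.sqrt ‖x * x‖ := by gcongr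
    _ = _ := Real.mul_self_sqrt (norm_nonneg _)

/-- If `‖x‖ > 1`, the powers `x ^ 2 ^ n` would outgrow any affine bound in the exponent. -/
theorem norm_le_one_of_norm_pow_le {B : Type*} [NormedRing B] {x : B} {c d : ℝ}
    (hx : ∀ n : ℕ, ‖x ^ 2 ^ n‖ = ‖x‖ ^ 2 ^ n) (h : ∀ n : ℕ, ‖x ^ n‖ ≤ c + n * d) : ‖x‖ ≤ 1 := by
  by_contra! hlt
  have h1 := tendsto_pow_const_div_const_pow_of_one_lt 1 hlt
  have h0 := tendsto_pow_const_div_const_pow_of_one_lt 0 hlt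
  have h2 := ((h0.const_mul c).add (h1.mul_const d)).comp
    (tendsto_pow_atTop_atTop_of_one_lt (one_lt_two : (1 : ℕ) < 2))
  have h3 : ∀ n : ℕ, (1 : ℝ) ≤ ((fun n : ℕ => c * ((n : ℝ) ^ 0 / ‖x‖ ^ n)
      + (n : ℝ) ^ 1 / ‖x‖ ^ n * d) ∘ fun n => 2 ^ n) n := by
    intro n
    have hpos : 0 < ‖x‖ ^ 2 ^ n := by positivity
    have := h (2 ^ n)
    rw [hx] at this
    simp only [Function.comp_apply, pow_zero, pow_one]
    rw [mul_one_div, div_mul_eq_mul_div, ← add_div, le_div_iff₀ hpos, one_mul]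
    exact this
  have := ge_of_tendsto' h2 h3
  norm_num at this

/-- A commuting triple `(V₁, V₂, V₃)` with `V₃` an isometry and `V₁ = V₂* V₃`. -/
structure IsEIsometry (V : Fin 3 → K →L[ℂ] K) : Prop where
  commute : ∀ i j, Commute (V i) (V j)
  isometry : star (V 2) * V 2 = 1
  star_mul_eq : star (V 1) * V 2 = V 0

namespace IsEIsometry

variable {V : Fin 3 → K →L[ℂ] K}

theorem star_mul_eq' (hV : IsEIsometry V) : star (V 0) * V 2 = V 1 := by
  rw [← hV.star_mul_eq, StarMul.star_mul, star_star, mul_assoc, hV.commute 1 2, ← mul_assoc,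
    hV.isometry, one_mul]

theorem reversible (hV : IsEIsometry V) (i : Fin 3) : Reversible (bicommutant V) (V 2) (V i) := by
  fin_cases i
  · exact ⟨1, V 1, mem_bicommutant V 1, by simpa using hV.star_mul_eq', by simpa using hV.star_mul_eq⟩
  · exact ⟨1, V 0, mem_bicommutant V 0, by simpa using hV.star_mul_eq, by simpa using hV.star_mul_eq'⟩
  · exact ⟨1, 1, one_mem _, by simpa using hV.isometry, by simp⟩

theorem norm_pow_two_pow (hV : IsEIsometry V) {x : K →L[ℂ] K} (hxA : x ∈ bicommutant V)
    (hx : Reversible (bicommutant V) (V 2) x) (n : ℕ) : ‖x ^ 2 ^ n‖ = ‖x‖ ^ 2 ^ n := by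
  have hA : ∀ x ∈ bicommutant V, ∀ y ∈ bicommutant V, x * y = y * x :=
    fun x hx y hy => commute_of_mem_bicommutant hV.commute hx hy
  have key : ∀ n : ℕ, Reversible (bicommutant V) (V 2) (x ^ 2 ^ n) := by
    intro n
    induction n with
    | zero => simpa using hx
    | succ n ih =>
      rw [pow_succ, pow_mul, pow_two]
      exact ih.mul hA (mem_bicommutant V 2) (Subalgebra.pow_mem _ hxA _)
        (Subalgebra.pow_mem _ hxA _) ih
  induction n with
  | zero => simp
  | succ n ih =>
    rw [pow_succ, pow_mul, pow_two, (key n).norm_mul_self hA hV.isometry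
      (Subalgebra.pow_mem _ hxA _), ih, pow_mul, pow_two]

theorem norm_le_one (hV : IsEIsometry V) (i : Fin 3) {c d : ℝ}
    (h : ∀ n : ℕ, ‖V i ^ n‖ ≤ c + n * d) : ‖V i‖ ≤ 1 :=
  norm_le_one_of_norm_pow_le (hV.norm_pow_two_pow (mem_bicommutant V i) (hV.reversible i)) h

/-- From `‖V₁h‖ = ‖V₀h‖`, `‖V₂h‖ = ‖h‖` and `⟨V₂h, V₁h⟩ = ⟨V₀h, h⟩`, the difference of the squares
is `(1 - |z|²)(‖h‖² - ‖V₀h‖²) ≥ 0`. -/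
theorem norm_sub_smul_le (hV : IsEIsometry V) (h0 : ‖V 0‖ ≤ 1) {z : ℂ} (hz : ‖z‖ ≤ 1) (h : K) :
    ‖(V 1 - z • V 2) h‖ ≤ ‖(1 - z • V 0) h‖ := by
  have ap : ∀ {f g : K →L[ℂ] K}, f = g → ∀ x, f x = g x := fun e x => by rw [e]
  have i2 : ‖V 2 h‖ ^ 2 = ‖h‖ ^ 2 := by
    have e := congrArg (fun y => inner ℂ y h) (ap hV.isometry h)
    simp only [mul_apply_eq_comp, star_eq_adjoint, adjoint_inner_left,
      one_apply_eq_self, inner_self_eq_norm_sq_to_K] at e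
    exact_mod_cast e
  have i1 : ‖V 1 h‖ ^ 2 = ‖V 0 h‖ ^ 2 := by
    have e1 : star (V 1) * V 1 = star (V 0) * V 0 := by
      calc star (V 1) * V 1 = star (V 1) * (star (V 0) * V 2) := by rw [hV.star_mul_eq']
        _ = star (V 1 * V 0) * V 2 := by
          rw [hV.commute 1 0, StarMul.star_mul, mul_assoc]
        _ = star (V 0) * V 0 := by rw [StarMul.star_mul, mul_assoc, hV.star_mul_eq]
    have e := congrArg (fun y => inner ℂ y h) (ap e1 h)
    simp only [mul_apply_eq_comp, star_eq_adjoint, adjoint_inner_left,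
      inner_self_eq_norm_sq_to_K] at e
    exact_mod_cast e
  have i3 : inner ℂ (V 2 h) (V 1 h) = inner ℂ (V 0 h) h := by
    rw [← ap hV.star_mul_eq h, mul_apply_eq_comp, star_eq_adjoint, adjoint_inner_left]
  have e1 : ‖(V 1 - z • V 2) h‖ ^ 2 = ‖V 0 h‖ ^ 2 - 2 * RCLike.re (inner ℂ (z • V 0 h) h)
      + ‖z‖ ^ 2 * ‖h‖ ^ 2 := by
    rw [_root_.sub_apply, _root_.smul_apply, @norm_sub_sq ℂ, i1,
      ← inner_conj_symm (V 1 h), inner_smul_left, i3, ← inner_smul_left, RCLike.conj_re,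
      norm_smul, mul_pow, i2]
  have e2 : ‖(1 - z • V 0) h‖ ^ 2 = ‖h‖ ^ 2 - 2 * RCLike.re (inner ℂ (z • V 0 h) h)
      + ‖z‖ ^ 2 * ‖V 0 h‖ ^ 2 := by
    rw [_root_.sub_apply, _root_.smul_apply, @norm_sub_sq ℂ,
      one_apply_eq_self,
      ← inner_conj_symm (𝕜 := ℂ) h, RCLike.conj_re,      norm_smul, mul_pow]
  refine abs_le_of_sq_le_sq' ?_ (norm_nonneg _) |>.2
  have h1 : ‖V 0 h‖ ^ 2 ≤ ‖h‖ ^ 2 := by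
    gcongr
    exact (le_opNorm _ _).trans (mul_le_of_le_one_left (norm_nonneg _) h0)
  have h2 : ‖z‖ ^ 2 ≤ 1 := pow_le_one₀ (norm_nonneg _) hz
  rw [e1, e2]
  nlinarith [mul_nonneg (sub_nonneg.2 h1) (sub_nonneg.2 h2)]

theorem norm_sub_smul_mul_le (hV : IsEIsometry V) (h0 : ‖V 0‖ ≤ 1) {z : ℂ} (hz : ‖z‖ ≤ 1)
    {G : K →L[ℂ] K} (hG : (1 - z • V 0) * G = 1) : ‖(V 1 - z • V 2) * G‖ ≤ 1 := by
  refine opNorm_le_bound _ zero_le_one fun k => ?_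
  refine (hV.norm_sub_smul_le h0 hz (G k)).trans_eq ?_
  rw [one_mul, ← mul_apply_eq_comp, hG, one_apply_eq_self]

open MvPolynomial BicommutantAlgebra in
theorem norm_polyEval_le_supNorm (hV : IsEIsometry V) (h0 : ‖V 0‖ ≤ 1)
    (p : MvPolynomial (Fin 3) ℂ) : ‖polyEval V p‖ ≤ supNorm p := by
  have hA : ∀ x ∈ bicommutant V, ∀ y ∈ bicommutant V, x * y = y * x :=
    fun x hx y hy => commute_of_mem_bicommutant hV.commute hx hy
  have hrev : Reversible (bicommutant V) (V 2) (val (aeval (gen hV.commute) p)) := by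
    induction p using MvPolynomial.induction_on with
    | C c =>
      rw [aeval_C, AlgHom.commutes]
      exact Reversible.algebraMap c
    | add p q hp hq =>
      rw [map_add, map_add]
      exact hp.add hA (mem_bicommutant V 2) hV.isometry (val_mem _) (val_mem _) hq
    | mul_X p i hp =>
      rw [map_mul, aeval_X, map_mul]
      exact hp.mul hA (mem_bicommutant V 2) (val_mem _) (val_mem _) (hV.reversible i)
  rw [← val_aeval_gen (hT := hV.commute), norm_val]
  refine norm_aeval_le_supNorm (fun z w hz hw => ?_) fun n => ?_
  · exact isUnit_pencil_gen hV.commute h0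
      (fun z hz G hG _ => hV.norm_sub_smul_mul_le h0 hz.le hG) hz hw
  · rw [← norm_val, ← norm_val, map_pow]
    exact hV.norm_pow_two_pow (val_mem _) hrev n

end IsEIsometry

section Compression

variable {H : Type*} [NormedAddCommGroup H] [InnerProductSpace ℂ H] [CompleteSpace H]

/-- A commuting triple `T` that is intertwined with an `𝔼`-isometry `V` by a coisometry `P`
is an `𝔼`-contraction. -/
theorem IsEContraction.of_intertwine {T : Fin 3 → H →L[ℂ] H} {V : Fin 3 → K →L[ℂ] K}
    (hT : ∀ i j, Commute (T i) (T j)) (hT0 : ‖T 0‖ ≤ 1) (hV : IsEIsometry V) (hV0 : ‖V 0‖ ≤ 1)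
    {P : K →L[ℂ] H} {J : H →L[ℂ] K} (hP : ‖P‖ ≤ 1) (hJ : ‖J‖ ≤ 1) (hPJ : ∀ h, P (J h) = h)
    (hPV : ∀ i k, P (V i k) = T i (P k)) : IsEContraction T := by
  -- Here `R = P W J`, so norm estimates descend from `K` to `H`.
  have hnorm : ∀ (R : H →L[ℂ] H) (W : K →L[ℂ] K), (∀ k, P (W k) = R (P k)) → ‖R‖ ≤ ‖W‖ := by
    intro R W hRW
    refine opNorm_le_bound _ (norm_nonneg _) fun h => ?_
    calc ‖R h‖ = ‖P (W (J h))‖ := by rw [hRW, hPJ]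
      _ ≤ ‖P‖ * (‖W‖ * (‖J‖ * ‖h‖)) := by
        refine (le_opNorm _ _).trans ?_
        gcongr
        refine (le_opNorm _ _).trans ?_
        gcongr
        exact le_opNorm _ _
      _ ≤ 1 * (‖W‖ * (1 * ‖h‖)) := by gcongr
      _ = ‖W‖ * ‖h‖ := by ring
  have hpow : ∀ i n k, P ((V i ^ n) k) = (T i ^ n) (P k) := by
    intro i n
    induction n with
    | zero => intro k; simp
    | succ n ih =>
      intro k
      rw [pow_succ', pow_succ', mul_apply_eq_comp, mul_apply_eq_comp, hPV,
        ih]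
  refine ⟨hT, ?_, fun p => ?_⟩
  · refine taylorSpectrum_subset_closure_tetrablock hT fun z w hz hw => ?_
    have hu := isUnit_pencil_gen hT hT0 (z := z) (w := w) ?_ hz hw
    · obtain ⟨u, hu⟩ := hu
      refine ⟨BicommutantAlgebra.val (hT := hT) ↑u⁻¹, fun i => commute_of_mem_bicommutant hT
        (BicommutantAlgebra.val_mem _) (mem_bicommutant T i), ?_⟩
      have := congrArg BicommutantAlgebra.val u.inv_mul
      rw [hu] at this
      simpa [BicommutantAlgebra.val_gen] using this
    · intro z hz G _ hG
      have hVu : IsUnit (1 - z • V 0) := by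
        refine isUnit_one_sub_of_norm_lt_one ?_
        refine (norm_smul_le _ _).trans_lt ?_
        exact mul_lt_one_of_nonneg_of_lt_one_left (norm_nonneg _) hz hV0
      obtain ⟨u, hu⟩ := hVu
      have hGV : (1 - z • V 0) * (↑u⁻¹ : K →L[ℂ] K) = 1 := by rw [← hu, u.mul_inv]
      refine (hnorm _ _ fun k => ?_).trans (hV.norm_sub_smul_mul_le hV0 hz.le hGV)
      -- `P` also intertwines the inverses of `1 - z V₀` and `1 - z T₀`.
      have e1 : P k = (1 - z • T 0) (P ((↑u⁻¹ : K →L[ℂ] K) k)) := by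
        conv_lhs => rw [← one_apply_eq_self (F := K →L[ℂ] K) k, ← hGV]
        simp [hPV]
      have e2 : G (P k) = P ((↑u⁻¹ : K →L[ℂ] K) k) := by
        rw [e1, ← mul_apply_eq_comp, hG, one_apply_eq_self]
      simp [hPV, e2]
  · refine (hnorm _ _ fun k => ?_).trans (hV.norm_polyEval_le_supNorm hV0 p)
    simp only [polyEval, _root_.sum_apply, _root_.smul_apply, map_sum, map_smul, mul_apply_eq_comp, hpow]

end Compression

end Hilbert

/-! ### Numerical radius and normal contractions. -/

section NumericalRadius

variable {D : Type*} [NormedAddCommGroup D] [InnerProductSpace ℂ D]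

theorem norm_inner_le_of_numericalRadius_le_one {A : D →L[ℂ] D} (hA : numericalRadius A ≤ 1)
    (x : D) : ‖inner ℂ (A x) x‖ ≤ ‖x‖ ^ 2 := by
  have hb : BddAbove {r : ℝ | ∃ x : D, ‖x‖ = 1 ∧ r = ‖inner ℂ (A x) x‖} := by
    refine ⟨‖A‖, ?_⟩
    rintro _ ⟨x, hx, rfl⟩
    calc ‖inner ℂ (A x) x‖ ≤ ‖A x‖ * ‖x‖ := norm_inner_le_norm _ _
      _ ≤ ‖A‖ * ‖x‖ * ‖x‖ := by gcongr; exact le_opNorm _ _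
      _ = ‖A‖ := by rw [hx, mul_one, mul_one]
  rcases eq_or_ne x 0 with rfl | hx
  · simp
  have hx' : ‖x‖ ≠ 0 := norm_ne_zero_iff.2 hx
  let e : D := ((‖x‖⁻¹ : ℝ) : ℂ) • x
  have he : ‖e‖ = 1 := by
    simp [e, norm_smul, hx']
  have hxe : x = ((‖x‖ : ℝ) : ℂ) • e := by
    rw [smul_smul, ← Complex.ofReal_mul, mul_inv_cancel₀ hx']
    simp
  have h1 : ‖inner ℂ (A e) e‖ ≤ 1 := (le_csSup hb ⟨e, he, rfl⟩).trans hA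
  rw [hxe, map_smul, inner_smul_left, inner_smul_right, norm_smul, he, norm_mul, norm_mul]
  simp only [RCLike.norm_conj, Complex.norm_real, norm_norm]
  nlinarith [sq_nonneg ‖x‖]

theorem exists_norm_add_eq (a b : ℂ) :
    ∃ z : ℂ, ‖z‖ = 1 ∧ ‖a + starRingEnd ℂ z * b‖ = ‖a‖ + ‖b‖ := by
  refine ⟨starRingEnd ℂ (Complex.exp (((a.arg - b.arg : ℝ) : ℂ) * Complex.I)), ?_, ?_⟩
  · rw [RCLike.norm_conj, Complex.norm_exp_ofReal_mul_I]
  · have h : a + Complex.exp (((a.arg - b.arg : ℝ) : ℂ) * Complex.I) * b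
        = ((‖a‖ + ‖b‖ : ℝ) : ℂ) * Complex.exp (a.arg * Complex.I) := by
      have e : Complex.exp (a.arg * Complex.I)
          = Complex.exp (((a.arg - b.arg : ℝ) : ℂ) * Complex.I)
            * Complex.exp (b.arg * Complex.I) := by
        rw [← Complex.exp_add]
        congr 1
        push_cast
        ring
      rw [Complex.ofReal_add, add_mul, Complex.norm_mul_exp_arg_mul_I, e, mul_left_comm,
        Complex.norm_mul_exp_arg_mul_I]
    rw [RCLike.conj_conj, h, norm_mul, Complex.norm_exp_ofReal_mul_I, mul_one, Complex.norm_real,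
      Real.norm_of_nonneg (by positivity)]

variable [CompleteSpace D]

/-- For `|k| > 1` the form of `k - N` is bounded below by `|k| - 1`, so `k - N` is invertible; a
normal operator has norm equal to its spectral radius. -/
theorem norm_le_one_of_isStarNormal {N : D →L[ℂ] D} (hN : IsStarNormal N)
    (h : ∀ x, ‖inner ℂ (N x) x‖ ≤ ‖x‖ ^ 2) : ‖N‖ ≤ 1 := by
  have hr : spectralRadius ℂ N ≤ 1 := by
    refine iSup₂_le fun k hk => ?_
    by_contra! hlt
    have hk1 : 1 < ‖k‖ := by
      have : (1 : NNReal) < ‖k‖₊ := by exact_mod_cast hlt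
      exact_mod_cast this
    refine hk (isUnit_of_forall_le_norm_inner_map _ (c := (‖k‖ - 1).toNNReal)
      (Real.toNNReal_pos.2 (by linarith)) fun x => ?_)
    have e : inner ℂ ((algebraMap ℂ (D →L[ℂ] D) k - N) x) x
        = starRingEnd ℂ k * (‖x‖ : ℂ) ^ 2 - inner ℂ (N x) x := by
      simp [Algebra.algebraMap_eq_smul_one, inner_self_eq_norm_sq_to_K, mul_comm]
    rw [e]
    have h1 := norm_sub_norm_le (starRingEnd ℂ k * (‖x‖ : ℂ) ^ 2) (inner ℂ (N x) x)
    rw [norm_mul, RCLike.norm_conj, norm_pow, Complex.norm_real, norm_norm] at h1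
    have := h x
    rw [Real.coe_toNNReal _ (by linarith)]
    nlinarith
  rw [hN.spectralRadius_eq_nnnorm] at hr
  exact_mod_cast hr

/-- The operators `A₁ + z A₂*` are normal contractions. -/
theorem norm_add_smul_adjoint_le_one {A₁ A₂ : D →L[ℂ] D} (hA : Commute A₁ A₂)
    (hcomm : adjoint A₁ * A₁ - A₁ * adjoint A₁ = adjoint A₂ * A₂ - A₂ * adjoint A₂)
    (hω : ∀ z : ℂ, ‖z‖ = 1 → numericalRadius (A₁ + z • A₂) ≤ 1) {ζ : ℂ} (hζ : ‖ζ‖ = 1) :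
    ‖A₁ + ζ • adjoint A₂‖ ≤ 1 := by
  refine norm_le_one_of_isStarNormal ⟨?_⟩ fun x => ?_
  · have h1 : starRingEnd ℂ ζ * ζ = 1 := by rw [RCLike.conj_mul, hζ]; simp
    have h2 : adjoint A₁ * adjoint A₂ = adjoint A₂ * adjoint A₁ := by
      simpa [star_eq_adjoint] using (hA.symm.star_star).eq.symm
    have h3 : A₁ * A₂ = A₂ * A₁ := hA
    have h4 : adjoint A₁ * A₁ = adjoint A₂ * A₂ - A₂ * adjoint A₂ + A₁ * adjoint A₁ := by
      rw [← hcomm]; abel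
    simp only [Commute, SemiconjBy, star_eq_adjoint, map_add, LinearIsometryEquiv.map_smulₛₗ,
      adjoint_adjoint, add_mul, mul_add, smul_mul_assoc, mul_smul_comm, h2, h3, h4]
    have e : ∀ R : D →L[ℂ] D, ζ • starRingEnd ℂ ζ • R = R := fun R => by
      rw [smul_smul, mul_comm, h1, one_smul]
    have e' : ∀ R : D →L[ℂ] D, starRingEnd ℂ ζ • ζ • R = R := fun R => by
      rw [smul_smul, h1, one_smul]
    simp only [smul_add, e, e']
    abel
  -- Aligning the two phases yields `|⟨A₁x, x⟩| + |⟨A₂x, x⟩| ≤ ‖x‖²`, which no longer sees the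
  -- adjoint or `ζ`.
  · obtain ⟨z, hz, hsum⟩ := exists_norm_add_eq (inner ℂ (A₁ x) x) (inner ℂ (A₂ x) x)
    have h1 := norm_inner_le_of_numericalRadius_le_one (hω z hz) x
    rw [_root_.add_apply, _root_.smul_apply, inner_add_left, inner_smul_left, hsum] at h1
    calc ‖inner ℂ ((A₁ + ζ • adjoint A₂) x) x‖
        = ‖inner ℂ (A₁ x) x + starRingEnd ℂ ζ * inner ℂ x (A₂ x)‖ := by
          rw [_root_.add_apply, _root_.smul_apply, inner_add_left, inner_smul_left,
            adjoint_inner_left]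
      _ ≤ ‖inner ℂ (A₁ x) x‖ + ‖starRingEnd ℂ ζ * inner ℂ x (A₂ x)‖ := norm_add_le _ _
      _ = ‖inner ℂ (A₁ x) x‖ + ‖inner ℂ (A₂ x) x‖ := by
          rw [norm_mul, RCLike.norm_conj, hζ, one_mul, norm_inner_symm x]
      _ ≤ ‖x‖ ^ 2 := h1

end NumericalRadius

/-! ### Toeplitz operators with linear symbol on `ℓ²(D)`. -/

section Toeplitz

open Finset

theorem lp_norm_le_of_sum_range_le {E : Type*} [NormedAddCommGroup E] {x : lp (fun _ : ℕ => E) 2} {C : ℝ}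
    (h : ∀ n, ∑ k ∈ range n, ‖x k‖ ^ 2 ≤ C ^ 2) (hC : 0 ≤ C) : ‖x‖ ≤ C := by
  refine lp.norm_le_of_forall_sum_le (by norm_num) hC fun s => ?_
  obtain ⟨n, hn⟩ := s.exists_nat_subset_range
  simp only [ENNReal.toReal_ofNat, Real.rpow_two]
  exact (sum_le_sum_of_subset_of_nonneg hn fun _ _ _ => by positivity).trans (h n)

theorem lp_sum_norm_sq_le {E : Type*} [NormedAddCommGroup E] (x : lp (fun _ : ℕ => E) 2) (n : ℕ) :
    ∑ k ∈ range n, ‖x k‖ ^ 2 ≤ ‖x‖ ^ 2 := by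
  simpa using lp.sum_rpow_le_norm_rpow (p := 2) (by norm_num) x (range n)

variable {D : Type*} [NormedAddCommGroup D] [InnerProductSpace ℂ D]

/-- Parseval's identity for the discrete Fourier transform. -/
theorem sum_norm_sq_dft {M : ℕ} {ω : ℂ} (hω : IsPrimitiveRoot ω M) (hM : M ≠ 0) (y : ℕ → D) :
    ∑ j ∈ range M, ‖∑ k ∈ range M, (ω ^ j) ^ k • y k‖ ^ 2 = M * ∑ k ∈ range M, ‖y k‖ ^ 2 := by
  have hn : ‖ω‖ = 1 := hω.norm'_eq_one hM
  have hω0 : ω ≠ 0 := hω.ne_zero hM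
  have hconj : starRingEnd ℂ ω = ω⁻¹ := by
    rw [Complex.inv_def, Complex.normSq_eq_norm_sq, hn]; simp
  have horth : ∀ k ∈ range M, ∀ l ∈ range M,
      ∑ j ∈ range M, starRingEnd ℂ ((ω ^ j) ^ k) * (ω ^ j) ^ l = if k = l then (M : ℂ) else 0 := by
    intro k hk l hl
    have e : ∀ j, starRingEnd ℂ ((ω ^ j) ^ k) * (ω ^ j) ^ l = ((ω⁻¹) ^ k * ω ^ l) ^ j := by
      intro j
      rw [map_pow, map_pow, hconj, mul_pow, ← pow_mul, ← pow_mul, ← pow_mul, ← pow_mul,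
        mul_comm j k, mul_comm j l]
    simp only [e]
    split_ifs with h
    · subst h
      have : (ω⁻¹) ^ k * ω ^ k = 1 := by rw [← mul_pow, inv_mul_cancel₀ hω0, one_pow]
      simp only [this, one_pow, sum_const, card_range, nsmul_eq_mul, mul_one]
    · have hne : (ω⁻¹) ^ k * ω ^ l ≠ 1 := by
        intro h1
        rw [inv_pow, inv_mul_eq_one₀ (pow_ne_zero _ hω0)] at h1
        exact h (hω.pow_inj (mem_range.1 hk) (mem_range.1 hl) h1)
      have hM1 : ((ω⁻¹) ^ k * ω ^ l) ^ M = 1 := by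
        rw [mul_pow, ← pow_mul, ← pow_mul, mul_comm k, mul_comm l, pow_mul, pow_mul, inv_pow,
          hω.pow_eq_one]
        simp
      have := mul_geom_sum ((ω⁻¹) ^ k * ω ^ l) M
      rw [hM1, sub_self] at this
      exact (mul_eq_zero.1 this).resolve_left (sub_ne_zero.2 hne)
  have hc : ((∑ j ∈ range M, ‖∑ k ∈ range M, (ω ^ j) ^ k • y k‖ ^ 2 : ℝ) : ℂ)
      = ((M * ∑ k ∈ range M, ‖y k‖ ^ 2 : ℝ) : ℂ) := by
    push_cast
    have e : ∀ v : D, (‖v‖ : ℂ) ^ 2 = inner ℂ v v := fun v =>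
      (inner_self_eq_norm_sq_to_K (𝕜 := ℂ) v).symm
    simp only [e, sum_inner, inner_sum, inner_smul_left, inner_smul_right, mul_sum]
    rw [sum_comm]
    refine sum_congr rfl fun l hl => ?_
    rw [sum_comm]
    calc _ = ∑ k ∈ range M, (if k = l then (M : ℂ) else 0) * inner ℂ (y k) (y l) := by
          refine sum_congr rfl fun k hk => ?_
          rw [← horth k hk l hl, sum_mul]
          refine sum_congr rfl fun j _ => ?_
          ring
      _ = _ := by simp only [ite_mul, zero_mul, sum_ite_eq', hl, if_true]
  exact_mod_cast hc

/-- The sequence `(A x₀, A x₁ + B x₀, A x₂ + B x₁, …)`. -/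
def toeplitzSeq (A B : D →L[ℂ] D) (x : ℕ → D) : ℕ → D
  | 0 => A (x 0)
  | k + 1 => A (x (k + 1)) + B (x k)

/-- The Fourier transform turns the sequence map into multiplication by `A + ζB`, contractive at
each root of unity; Parseval is applied on both sides. -/
theorem sum_norm_sq_toeplitzSeq_le {A B : D →L[ℂ] D} (h : ∀ ζ : ℂ, ‖ζ‖ = 1 → ‖A + ζ • B‖ ≤ 1)
    (x : ℕ → D) (n : ℕ) :
    ∑ k ∈ range n, ‖toeplitzSeq A B x k‖ ^ 2 ≤ ∑ k ∈ range n, ‖x k‖ ^ 2 := by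
  let t : ℕ → D := fun k => if k < n then x k else 0
  have ht : ∀ k < n, t k = x k := fun k hk => if_pos hk
  have htn : t n = 0 := if_neg (lt_irrefl n)
  have hy : ∀ k < n, toeplitzSeq A B t k = toeplitzSeq A B x k := by
    rintro (_ | k) hk
    · simp [toeplitzSeq, ht 0 hk]
    · simp [toeplitzSeq, ht _ hk, ht k (Nat.lt_of_succ_lt hk)]
  -- Truncation leaves `n` entries and the symbol adds one degree, so `n + 1` nodes avoid
  -- wrap-around.
  obtain ⟨ω, hω⟩ : ∃ ω : ℂ, IsPrimitiveRoot ω (n + 1) :=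
    ⟨_, Complex.isPrimitiveRoot_exp (n + 1) n.succ_ne_zero⟩
  have hhat : ∀ ζ : ℂ, ∑ k ∈ range (n + 1), ζ ^ k • toeplitzSeq A B t k
      = (A + ζ • B) (∑ k ∈ range (n + 1), ζ ^ k • t k) := by
    intro ζ
    have hB : (ζ • B) (∑ k ∈ range (n + 1), ζ ^ k • t k)
        = ∑ k ∈ range n, ζ ^ (k + 1) • B (t k) := by
      rw [sum_range_succ, htn, smul_zero, add_zero, map_sum]
      refine sum_congr rfl fun k _ => ?_
      rw [_root_.smul_apply, map_smul, smul_smul, pow_succ']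
    rw [_root_.add_apply, hB, map_sum, sum_range_succ', sum_range_succ' (fun k => A _)]
    simp only [toeplitzSeq, smul_add, sum_add_distrib, map_smul]
    abel
  have h1 := sum_norm_sq_dft hω n.succ_ne_zero (toeplitzSeq A B t)
  have h2 := sum_norm_sq_dft hω n.succ_ne_zero t
  have h3 : ∑ k ∈ range (n + 1), ‖toeplitzSeq A B t k‖ ^ 2 ≤ ∑ k ∈ range (n + 1), ‖t k‖ ^ 2 := by
    have hpos : (0 : ℝ) < ((n + 1 : ℕ) : ℝ) := by positivity
    refine le_of_mul_le_mul_left ?_ hpos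
    rw [← h1, ← h2]
    refine sum_le_sum fun j _ => ?_
    rw [hhat]
    gcongr
    refine (le_opNorm _ _).trans (mul_le_of_le_one_left (norm_nonneg _) (h _ ?_))
    rw [norm_pow, hω.norm'_eq_one n.succ_ne_zero, one_pow]
  calc ∑ k ∈ range n, ‖toeplitzSeq A B x k‖ ^ 2
      = ∑ k ∈ range n, ‖toeplitzSeq A B t k‖ ^ 2 :=
        sum_congr rfl fun k hk => by rw [hy k (mem_range.1 hk)]
    _ ≤ ∑ k ∈ range (n + 1), ‖toeplitzSeq A B t k‖ ^ 2 := by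
        rw [sum_range_succ]
        exact le_add_of_nonneg_right (by positivity)
    _ ≤ ∑ k ∈ range (n + 1), ‖t k‖ ^ 2 := h3
    _ = ∑ k ∈ range n, ‖x k‖ ^ 2 := by
        rw [sum_range_succ, htn]
        simp only [norm_zero, ne_eq, OfNat.ofNat_ne_zero, not_false_eq_true, zero_pow, add_zero]
        exact sum_congr rfl fun k hk => by rw [ht k (mem_range.1 hk)]

theorem sum_norm_sq_toeplitzSeq_le' (A B : D →L[ℂ] D) (x : ℕ → D) (n : ℕ) :
    ∑ k ∈ range n, ‖toeplitzSeq A B x k‖ ^ 2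
      ≤ (‖A‖ + ‖B‖) ^ 2 * ∑ k ∈ range n, ‖x k‖ ^ 2 := by
  rcases (add_nonneg (norm_nonneg A) (norm_nonneg B)).eq_or_lt with h0 | h0
  · have hA : A = 0 := norm_eq_zero.1 (by linarith [norm_nonneg A, norm_nonneg B])
    have hB : B = 0 := norm_eq_zero.1 (by linarith [norm_nonneg A, norm_nonneg B])
    subst hA hB
    have : ∀ k, toeplitzSeq (0 : D →L[ℂ] D) 0 x k = 0 := by
      rintro (_ | k) <;> simp [toeplitzSeq]
    simp [this]
  · set c : ℝ := ‖A‖ + ‖B‖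
    have hc : ‖(c : ℂ)⁻¹‖ = c⁻¹ := by simp [abs_of_pos h0]
    have h1 := sum_norm_sq_toeplitzSeq_le (A := (c : ℂ)⁻¹ • A) (B := (c : ℂ)⁻¹ • B)
      (fun ζ hζ => by
        rw [smul_comm, ← smul_add, norm_smul, hc, inv_mul_le_one₀ h0]
        refine (norm_add_le _ _).trans ?_
        rw [norm_smul, hζ, one_mul]) x n
    have h2 : ∀ k, toeplitzSeq ((c : ℂ)⁻¹ • A) ((c : ℂ)⁻¹ • B) x k
        = (c : ℂ)⁻¹ • toeplitzSeq A B x k := by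
      rintro (_ | k) <;> simp [toeplitzSeq]
    simp only [h2, norm_smul, hc, mul_pow, ← mul_sum, inv_pow] at h1
    rwa [inv_mul_le_iff₀ (by positivity)] at h1

theorem memℓp_toeplitzSeq (A B : D →L[ℂ] D) (x : lp (fun _ : ℕ => D) 2) :
    Memℓp (toeplitzSeq A B x) 2 := by
  refine memℓp_gen' (C := (‖A‖ + ‖B‖) ^ 2 * ‖x‖ ^ 2) fun s => ?_
  obtain ⟨n, hn⟩ := s.exists_nat_subset_range
  simp only [ENNReal.toReal_ofNat, Real.rpow_two]
  refine (sum_le_sum_of_subset_of_nonneg hn fun _ _ _ => by positivity).trans ?_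
  refine (sum_norm_sq_toeplitzSeq_le' A B x n).trans ?_
  gcongr
  exact lp_sum_norm_sq_le x n

/-- The Toeplitz operator on `ℓ²(D)` with symbol `A + z B`. -/
noncomputable def toeplitz (A B : D →L[ℂ] D) :
    lp (fun _ : ℕ => D) 2 →L[ℂ] lp (fun _ : ℕ => D) 2 :=
  LinearMap.mkContinuous
    { toFun := fun x => ⟨toeplitzSeq A B x, memℓp_toeplitzSeq A B x⟩
      map_add' := fun x y => by
        ext (_ | k)
        · exact map_add A _ _
        · change A (x (k + 1) + y (k + 1)) + B (x k + y k)
            = A (x (k + 1)) + B (x k) + (A (y (k + 1)) + B (y k))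
          rw [map_add, map_add]
          abel
      map_smul' := fun c x => by
        ext (_ | k) <;> simp [toeplitzSeq] }
    (‖A‖ + ‖B‖) fun x => by
      refine lp_norm_le_of_sum_range_le (fun n => ?_) (by positivity)
      refine (sum_norm_sq_toeplitzSeq_le' A B x n).trans ?_
      rw [mul_pow]
      gcongr
      exact lp_sum_norm_sq_le x n

theorem toeplitz_apply_zero (A B : D →L[ℂ] D) (x : lp (fun _ : ℕ => D) 2) :
    toeplitz A B x 0 = A (x 0) := rfl

theorem toeplitz_apply_succ (A B : D →L[ℂ] D) (x : lp (fun _ : ℕ => D) 2) (k : ℕ) :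
    toeplitz A B x (k + 1) = A (x (k + 1)) + B (x k) := rfl

theorem norm_toeplitz_le_one {A B : D →L[ℂ] D} (h : ∀ ζ : ℂ, ‖ζ‖ = 1 → ‖A + ζ • B‖ ≤ 1) :
    ‖toeplitz A B‖ ≤ 1 := by
  refine opNorm_le_bound _ zero_le_one fun x => ?_
  refine lp_norm_le_of_sum_range_le (fun n => ?_) (by positivity)
  rw [one_mul]
  exact (sum_norm_sq_toeplitzSeq_le h x n).trans (lp_sum_norm_sq_le x n)

theorem hasSum_inner_toeplitz_zero_left (B : D →L[ℂ] D) (x y : lp (fun _ : ℕ => D) 2) :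
    HasSum (fun k => inner ℂ (B (x k)) (y (k + 1))) (inner ℂ (toeplitz 0 B x) y) := by
  have h := lp.hasSum_inner (𝕜 := ℂ) (toeplitz 0 B x) y
  rw [← hasSum_nat_add_iff' 1] at h
  simpa [toeplitz_apply_zero, toeplitz_apply_succ] using h

theorem hasSum_inner_toeplitz_zero_right (A : D →L[ℂ] D) (x y : lp (fun _ : ℕ => D) 2) :
    HasSum (fun k => inner ℂ (A (x k)) (y k)) (inner ℂ (toeplitz A 0 x) y) := by
  have h := lp.hasSum_inner (𝕜 := ℂ) (toeplitz A 0 x) y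
  refine h.congr_fun ?_
  rintro (_ | k) <;> simp [toeplitz_apply_zero, toeplitz_apply_succ]

theorem toeplitz_eq_add (A B : D →L[ℂ] D) : toeplitz A B = toeplitz A 0 + toeplitz 0 B := by
  ext x (_ | k) <;> simp [toeplitz_apply_zero, toeplitz_apply_succ]

/-- On the circle, `(A + ζB)* ζ = B* + ζA*`. -/
theorem inner_shift_toeplitz [CompleteSpace D] (A B : D →L[ℂ] D)
    (x y : lp (fun _ : ℕ => D) 2) :
    inner ℂ (toeplitz 0 1 x) (toeplitz A B y)
      = inner ℂ (toeplitz (adjoint B) (adjoint A) x) y := by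
  have h1 := hasSum_inner_toeplitz_zero_left (1 : D →L[ℂ] D) x (toeplitz A B y)
  have h2 := (hasSum_inner_toeplitz_zero_right (adjoint B) x y).add
    (hasSum_inner_toeplitz_zero_left (adjoint A) x y)
  rw [← inner_add_left, ← _root_.add_apply, ← toeplitz_eq_add] at h2
  refine h1.unique (h2.congr_fun fun k => ?_)
  rw [toeplitz_apply_succ, inner_add_right, adjoint_inner_left, adjoint_inner_left, add_comm]
  rfl

end Toeplitz

/-! ### The lower triangular dilation. -/

section Dilation

variable {H D : Type*} [NormedAddCommGroup H] [InnerProductSpace ℂ H]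
  [NormedAddCommGroup D] [InnerProductSpace ℂ D]

/-- The Hilbert space `H ⊕ ℓ²(D)`. -/
abbrev DilationSpace (H D : Type*) [NormedAddCommGroup H] [NormedAddCommGroup D] : Type _ :=
  WithLp 2 (H × lp (fun _ : ℕ => D) 2)

/-- The lower triangular operator `(h, x) ↦ (T h, (C h, 0, 0, …) + (A + z B) x)` on
`H ⊕ ℓ²(D)`. -/
noncomputable def lowerTriangular (T : H →L[ℂ] H) (C : H →L[ℂ] D) (A B : D →L[ℂ] D) :
    DilationSpace H D →L[ℂ] DilationSpace H D :=
  (WithLp.prodContinuousLinearEquiv 2 ℂ H (lp (fun _ : ℕ => D) 2)).symm.toContinuousLinearMap ∘L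
    ((T ∘L WithLp.fstL 2 ℂ H (lp (fun _ : ℕ => D) 2)).prod
      (lp.singleContinuousLinearMap ℂ (fun _ : ℕ => D) 2 0 ∘L C ∘L
          WithLp.fstL 2 ℂ H (lp (fun _ : ℕ => D) 2)
        + toeplitz A B ∘L WithLp.sndL 2 ℂ H (lp (fun _ : ℕ => D) 2)))

theorem lowerTriangular_fst (T : H →L[ℂ] H) (C : H →L[ℂ] D) (A B : D →L[ℂ] D)
    (k : DilationSpace H D) : (lowerTriangular T C A B k).fst = T k.fst := rfl

theorem lowerTriangular_snd (T : H →L[ℂ] H) (C : H →L[ℂ] D) (A B : D →L[ℂ] D)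
    (k : DilationSpace H D) :
    (lowerTriangular T C A B k).snd = lp.single 2 0 (C k.fst) + toeplitz A B k.snd := rfl

/-- The hypotheses compare coefficients: `hA`, `hAB`, `hB` for the product of symbols, `h₀` and `h₁`
for coordinates 0 and 1 of the corner entry. -/
theorem commute_lowerTriangular {T T' : H →L[ℂ] H} {C C' : H →L[ℂ] D} {A A' B B' : D →L[ℂ] D}
    (hT : Commute T T') (hA : Commute A A') (hB : Commute B B')
    (hAB : A * B' + B * A' = A' * B + B' * A)
    (h₀ : C ∘L T' + A ∘L C' = C' ∘L T + A' ∘L C) (h₁ : B ∘L C' = B' ∘L C) :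
    Commute (lowerTriangular T C A B) (lowerTriangular T' C' A' B') := by
  have a : ∀ x, A (A' x) = A' (A x) := fun x => DFunLike.congr_fun hA x
  have b : ∀ x, B (B' x) = B' (B x) := fun x => DFunLike.congr_fun hB x
  have ab : ∀ x, A (B' x) + B (A' x) = A' (B x) + B' (A x) := fun x => DFunLike.congr_fun hAB x
  have c₀ : ∀ x, C (T' x) + A (C' x) = C' (T x) + A' (C x) := fun x => DFunLike.congr_fun h₀ x
  have c₁ : ∀ x, B (C' x) = B' (C x) := fun x => DFunLike.congr_fun h₁ x
  refine ContinuousLinearMap.ext fun k => WithLp.ofLp_injective 2 (Prod.ext ?_ ?_)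
  · exact DFunLike.congr_fun hT k.fst
  · change (lowerTriangular T C A B (lowerTriangular T' C' A' B' k)).snd
      = (lowerTriangular T' C' A' B' (lowerTriangular T C A B k)).snd
    simp only [lowerTriangular_snd, lowerTriangular_fst]
    ext i
    rcases i with _ | _ | i
    · simp only [lp.coeFn_add, Pi.add_apply, lp.single_apply_self, toeplitz_apply_zero, map_add]
      rw [← add_assoc, ← add_assoc, c₀, a]
    · simp only [map_add, lp.coeFn_add, Pi.add_apply, toeplitz_apply_zero, toeplitz_apply_succ,
        lp.single_apply_self, lp.single_apply_ne _ _ _ (Nat.succ_ne_zero _), map_zero, zero_add]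
      linear_combination (norm := module) c₁ k.fst + a (k.snd 1) + ab (k.snd 0)
    · simp only [map_add, lp.coeFn_add, Pi.add_apply, toeplitz_apply_succ,
        lp.single_apply_ne _ _ _ (Nat.succ_ne_zero _), map_zero, zero_add]
      linear_combination (norm := module) a (k.snd (i + 2)) + ab (k.snd (i + 1)) + b (k.snd i)

theorem lowerTriangular_one : lowerTriangular (1 : H →L[ℂ] H) 0 (1 : D →L[ℂ] D) 0 = 1 := by
  refine ContinuousLinearMap.ext fun k => WithLp.ofLp_injective 2 (Prod.ext rfl ?_)
  change (lowerTriangular 1 0 1 0 k).snd = k.snd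
  rw [lowerTriangular_snd]
  ext (_ | i) <;> simp [toeplitz_apply_zero, toeplitz_apply_succ]

/-- The corner of the `n`-th power is a sum of `n` terms of norm at most `‖C‖`; the diagonal blocks
account for the 2. -/
theorem norm_lowerTriangular_pow_le {T : H →L[ℂ] H} {C : H →L[ℂ] D} {A B : D →L[ℂ] D}
    (hT : ‖T‖ ≤ 1) (hAB : ‖toeplitz A B‖ ≤ 1) (n : ℕ) :
    ‖lowerTriangular T C A B ^ n‖ ≤ 2 + n * ‖C‖ := by
  have h1 : ∀ n k, ‖((lowerTriangular T C A B ^ n) k).fst‖ ≤ ‖k.fst‖ := by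
    intro n
    induction n with
    | zero => intro k; simp
    | succ n ih =>
      intro k
      rw [pow_succ', mul_apply_eq_comp, lowerTriangular_fst]
      exact ((le_opNorm _ _).trans (mul_le_of_le_one_left (norm_nonneg _) hT)).trans (ih k)
  have h2 : ∀ n : ℕ, ∀ k, ‖((lowerTriangular T C A B ^ n) k).snd‖
      ≤ ‖k.snd‖ + n * ‖C‖ * ‖k.fst‖ := by
    intro n
    induction n with
    | zero => intro k; simp
    | succ n ih =>
      intro k
      rw [pow_succ', mul_apply_eq_comp, lowerTriangular_snd]
      refine (norm_add_le _ _).trans ?_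
      rw [lp.norm_single (by norm_num)]
      have e1 : ‖C ((lowerTriangular T C A B ^ n) k).fst‖ ≤ ‖C‖ * ‖k.fst‖ :=
        (le_opNorm _ _).trans (mul_le_mul_of_nonneg_left (h1 n k) (norm_nonneg _))
      have e2 := ((le_opNorm (toeplitz A B) ((lowerTriangular T C A B ^ n) k).snd).trans
        (mul_le_of_le_one_left (norm_nonneg _) hAB)).trans (ih k)
      calc _ ≤ ‖C‖ * ‖k.fst‖ + (‖k.snd‖ + n * ‖C‖ * ‖k.fst‖) := add_le_add e1 e2
        _ = _ := by push_cast; ring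
  refine opNorm_le_bound _ (by positivity) fun k => ?_
  set y := (lowerTriangular T C A B ^ n) k
  have hf := WithLp.norm_fst_le H k
  have hs := WithLp.norm_snd_le H k
  have hy : ‖y‖ ≤ ‖y.fst‖ + ‖y.snd‖ := by
    refine abs_le_of_sq_le_sq' ?_ (by positivity) |>.2
    rw [WithLp.prod_norm_sq_eq_of_L2]
    nlinarith [norm_nonneg y.fst, norm_nonneg y.snd]
  have := mul_le_mul_of_nonneg_left hf (by positivity : 0 ≤ n * ‖C‖)
  linarith [h1 n k, h2 n k]

variable [CompleteSpace H] [CompleteSpace D]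

/-- The product is again lower triangular because the shift's range has zero coordinate 0, which is
all that the adjoint corner sees. -/
theorem star_lowerTriangular_mul {T T' T'' : H →L[ℂ] H} {C C' C'' : H →L[ℂ] D}
    {A' A'' B' B'' : D →L[ℂ] D} (hT : adjoint T' ∘L T + adjoint C' ∘L C = T'')
    (hC : adjoint A' ∘L C = C'') (hA : adjoint B' = A'') (hB : adjoint A' = B'') :
    star (lowerTriangular T' C' A' B') * lowerTriangular T C 0 1
      = lowerTriangular T'' C'' A'' B'' := by
  subst hT hC hA hB
  refine ContinuousLinearMap.ext fun k => ext_inner_right ℂ fun k' => ?_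
  rw [mul_apply_eq_comp, star_eq_adjoint, adjoint_inner_left, WithLp.prod_inner_apply,
    WithLp.prod_inner_apply]
  simp only [WithLp.ofLp_fst, WithLp.ofLp_snd, lowerTriangular_fst, lowerTriangular_snd]
  rw [inner_add_left, inner_add_right (𝕜 := ℂ) (toeplitz 0 1 k.snd), inner_shift_toeplitz,
    lp.inner_single_left, lp.inner_single_right, inner_add_left (𝕜 := ℂ) _ _ k'.snd,
    lp.inner_single_left, lp.coeFn_add, Pi.add_apply, lp.single_apply_self, inner_add_right,
    toeplitz_apply_zero, toeplitz_apply_zero]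
  simp only [_root_.add_apply, ContinuousLinearMap.comp_apply, _root_.zero_apply,
    inner_zero_left, inner_add_left, adjoint_inner_left]
  ring

/-- The dilation of a commuting triple of contractions satisfying the fundamental equations, with
`Δ` in the role of the defect operator. -/
theorem IsEContraction.of_fundamental {T₁ T₂ T₃ : H →L[ℂ] H}
    (h12 : Commute T₁ T₂) (h13 : Commute T₁ T₃) (h23 : Commute T₂ T₃) (hT₁ : ‖T₁‖ ≤ 1)
    {Δ : H →L[ℂ] D} (hΔ : adjoint Δ ∘L Δ = 1 - adjoint T₃ * T₃)
    (hinj : Function.Injective (adjoint Δ)) {A₁ A₂ : D →L[ℂ] D} (hA : Commute A₁ A₂)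
    (hf₁ : T₁ - adjoint T₂ * T₃ = adjoint Δ ∘L A₁ ∘L Δ)
    (hf₂ : T₂ - adjoint T₁ * T₃ = adjoint Δ ∘L A₂ ∘L Δ)
    (hcomm : adjoint A₁ * A₁ - A₁ * adjoint A₁ = adjoint A₂ * A₂ - A₂ * adjoint A₂)
    (hnorm : ∀ z : ℂ, ‖z‖ = 1 → ‖A₁ + z • adjoint A₂‖ ≤ 1) :
    IsEContraction ![T₁, T₂, T₃] := by
  -- After applying the injective `Δ*`, both sides equal `S - T₃* S T₃`.
  have key : ∀ {S S' : H →L[ℂ] H} {A A' : D →L[ℂ] D}, Commute S T₃ →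
      S - adjoint S' * T₃ = adjoint Δ ∘L A ∘L Δ → S' - adjoint S * T₃ = adjoint Δ ∘L A' ∘L Δ →
      Δ ∘L S = A ∘L Δ + (adjoint A' ∘L Δ) ∘L T₃ := by
    intro S S' A A' hS h h'
    have h'' : adjoint S' - adjoint T₃ * S = adjoint Δ ∘L adjoint A' ∘L Δ := by
      have := congrArg adjoint h'
      simpa [ContinuousLinearMap.mul_def, adjoint_comp, ContinuousLinearMap.comp_assoc] using this
    ext x
    apply hinj
    have e1 : adjoint Δ (Δ (S x)) = S x - adjoint T₃ (T₃ (S x)) := DFunLike.congr_fun hΔ (S x)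
    have e2 : S x - adjoint S' (T₃ x) = adjoint Δ (A (Δ x)) := DFunLike.congr_fun h x
    have e3 : adjoint S' (T₃ x) - adjoint T₃ (S (T₃ x)) = adjoint Δ (adjoint A' (Δ (T₃ x))) :=
      DFunLike.congr_fun h'' (T₃ x)
    have e4 : S (T₃ x) = T₃ (S x) := DFunLike.congr_fun hS x
    simp only [ContinuousLinearMap.comp_apply, _root_.add_apply, map_add, e1, ← e2, ← e3, e4]
    abel
  have k₁ := key h13 hf₁ hf₂
  have k₂ := key h23 hf₂ hf₁
  have hA' : Commute (adjoint A₁) (adjoint A₂) := by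
    simpa only [star_eq_adjoint] using hA.star_star
  have hcomm' : A₁ * adjoint A₁ + adjoint A₂ * A₂ = A₂ * adjoint A₂ + adjoint A₁ * A₁ := by
    rw [sub_eq_iff_eq_add] at hcomm
    rw [hcomm]
    abel
  let V : Fin 3 → DilationSpace H D →L[ℂ] DilationSpace H D :=
    ![lowerTriangular T₁ (adjoint A₂ ∘L Δ) A₁ (adjoint A₂),
      lowerTriangular T₂ (adjoint A₁ ∘L Δ) A₂ (adjoint A₁), lowerTriangular T₃ Δ 0 1]
  have c01 : Commute (V 0) (V 1) := by
    refine commute_lowerTriangular h12 hA hA'.symm hcomm' ?_ ?_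
    -- The `ΔT₃` terms cancel since `A₁*`, `A₂*` commute; the `Δ` terms agree by equality of the
    -- self-commutators.
    · rw [ContinuousLinearMap.comp_assoc, ContinuousLinearMap.comp_assoc, k₁, k₂]
      ext x
      have e1 := DFunLike.congr_fun hcomm' (Δ x)
      have e2 := DFunLike.congr_fun hA' (Δ (T₃ x))
      simp only [_root_.add_apply, mul_apply_eq_comp, ContinuousLinearMap.comp_apply,
        map_add] at e1 e2 ⊢
      rw [e2, add_right_comm, add_comm (adjoint A₂ _), e1]
      abel
    · ext x
      exact DFunLike.congr_fun hA'.symm (Δ x)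
  have c2 : ∀ {S : H →L[ℂ] H} {A A' : D →L[ℂ] D}, Commute S T₃ →
      Δ ∘L S = A ∘L Δ + (adjoint A' ∘L Δ) ∘L T₃ →
      Commute (lowerTriangular S (adjoint A' ∘L Δ) A (adjoint A')) (lowerTriangular T₃ Δ 0 1) := by
    intro S A A' hS hk
    refine commute_lowerTriangular hS (Commute.zero_right _) (Commute.one_right _) ?_ ?_ rfl
    · simp
    · rw [hk, ContinuousLinearMap.zero_comp, add_zero, add_comm]
  have c02 : Commute (V 0) (V 2) := c2 h13 k₁
  have c12 : Commute (V 1) (V 2) := c2 h23 k₂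
  have hV : IsEIsometry V := by
    refine ⟨?_, ?_, ?_⟩
    · intro i j
      fin_cases i <;> fin_cases j
      exacts [Commute.refl _, c01, c02, c01.symm, Commute.refl _, c12, c02.symm, c12.symm,
        Commute.refl _]
    · rw [← lowerTriangular_one]
      refine star_lowerTriangular_mul ?_ (by simp) ?_ (by simp)
      · rw [hΔ]; simp [ContinuousLinearMap.mul_def]
      · simp [← star_eq_adjoint]
    · refine star_lowerTriangular_mul ?_ rfl (adjoint_adjoint _) rfl
      rw [adjoint_comp, adjoint_adjoint, ContinuousLinearMap.comp_assoc, ← hf₁,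
        ContinuousLinearMap.mul_def]
      abel
  have hT : ∀ i j, Commute (![T₁, T₂, T₃] i) (![T₁, T₂, T₃] j) := by
    intro i j
    fin_cases i <;> fin_cases j
    exacts [Commute.refl _, h12, h13, h12.symm, Commute.refl _, h23, h13.symm, h23.symm,
      Commute.refl _]
  have hV0 : ‖V 0‖ ≤ 1 :=
    hV.norm_le_one 0 (norm_lowerTriangular_pow_le hT₁ (norm_toeplitz_le_one hnorm))
  refine IsEContraction.of_intertwine hT hT₁ hV hV0
    (P := WithLp.fstL 2 ℂ H (lp (fun _ : ℕ => D) 2))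
    (J := (WithLp.prodContinuousLinearEquiv 2 ℂ H
      (lp (fun _ : ℕ => D) 2)).symm.toContinuousLinearMap ∘L ContinuousLinearMap.inl ℂ H _)
    ?_ ?_ (fun h => rfl) ?_
  · refine opNorm_le_bound _ zero_le_one fun k => ?_
    rw [one_mul]
    exact WithLp.norm_fst_le H k
  · refine opNorm_le_bound _ zero_le_one fun h => ?_
    rw [one_mul]
    exact (WithLp.norm_toLp_fst 2 H (lp (fun _ : ℕ => D) 2) h).le
  · intro i k
    fin_cases i <;> rfl

end Dilation

/-! ### The defect operator. -/

section Defect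

variable {H : Type*} [NormedAddCommGroup H] [InnerProductSpace ℂ H] [CompleteSpace H]

theorem star_defect (T : H →L[ℂ] H) : star (defect T) = defect T :=
  (CFC.sqrt_nonneg _).isSelfAdjoint

theorem defect_mul_defect {T : H →L[ℂ] H} (hT : ‖T‖ ≤ 1) :
    defect T * defect T = 1 - adjoint T * T := by
  refine CFC.sqrt_mul_sqrt_self _ ?_
  rw [sub_nonneg, ← star_eq_adjoint,
    ← CStarAlgebra.norm_le_one_iff_of_nonneg _ (star_mul_self_nonneg T),
    CStarRing.norm_star_mul_self]
  exact mul_le_one₀ hT (norm_nonneg _) hT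

theorem adjoint_defectTo_apply (T : H →L[ℂ] H) (d : defectSpace T) :
    adjoint (defectTo T) d = defect T d := by
  refine ext_inner_right ℂ fun h => ?_
  rw [adjoint_inner_left, ← adjoint_inner_right, ← star_eq_adjoint, star_defect]
  rfl

theorem injective_adjoint_defectTo (T : H →L[ℂ] H) :
    Function.Injective (adjoint (defectTo T)) := by
  rw [injective_iff_map_eq_zero]
  intro d hd
  rw [adjoint_defectTo_apply] at hd
  have h1 : (d : H) ∈ (LinearMap.range (defect T).toLinearMap)ᗮ := by
    rw [Submodule.mem_orthogonal]
    rintro _ ⟨h, rfl⟩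
    change inner ℂ (defect T h) (d : H) = 0
    rw [← adjoint_inner_right, ← star_eq_adjoint, star_defect, hd, inner_zero_right]
  rw [← Submodule.orthogonal_closure] at h1
  have := Submodule.inner_right_of_mem_orthogonal d.2 h1
  exact Subtype.ext (inner_self_eq_zero.1 this)

end Defect

end Tetrablock

theorem theorem3p3 {H : Type*} [NormedAddCommGroup H] [InnerProductSpace ℂ H] [CompleteSpace H]
    (T₁ T₂ T₃ : H →L[ℂ] H)
    (h12 : Commute T₁ T₂) (h13 : Commute T₁ T₃) (h23 : Commute T₂ T₃)
    (hT₁ : ‖T₁‖ ≤ 1) (hT₂ : ‖T₂‖ ≤ 1) (hT₃ : ‖T₃‖ ≤ 1)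
    (A₁ A₂ : Tetrablock.defectSpace T₃ →L[ℂ] Tetrablock.defectSpace T₃)
    (hA : Commute A₁ A₂)
    (hf₁ : T₁ - adjoint T₂ * T₃ = Tetrablock.defectCompress T₃ A₁)
    (hf₂ : T₂ - adjoint T₁ * T₃ = Tetrablock.defectCompress T₃ A₂)
    (hcomm : adjoint A₁ * A₁ - A₁ * adjoint A₁ = adjoint A₂ * A₂ - A₂ * adjoint A₂)
    (hω : ∀ z : ℂ, ‖z‖ = 1 → Tetrablock.numericalRadius (A₁ + z • A₂) ≤ 1) :
    Tetrablock.IsEContraction ![T₁, T₂, T₃] := by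
  have hcompress : ∀ A : Tetrablock.defectSpace T₃ →L[ℂ] Tetrablock.defectSpace T₃,
      Tetrablock.defectCompress T₃ A
        = adjoint (Tetrablock.defectTo T₃) ∘L A ∘L Tetrablock.defectTo T₃ := fun A => by
    ext x
    exact (Tetrablock.adjoint_defectTo_apply T₃ _).symm
  have hΔ : adjoint (Tetrablock.defectTo T₃) ∘L Tetrablock.defectTo T₃
      = 1 - adjoint T₃ * T₃ := by
    rw [← Tetrablock.defect_mul_defect hT₃]
    ext x
    exact Tetrablock.adjoint_defectTo_apply T₃ _
  refine Tetrablock.IsEContraction.of_fundamental h12 h13 h23 hT₁ hΔ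
    (Tetrablock.injective_adjoint_defectTo T₃) hA (hf₁.trans (hcompress A₁))
    (hf₂.trans (hcompress A₂)) hcomm
    fun z hz => Tetrablock.norm_add_smul_adjoint_le_one hA hcomm hω hz
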